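/- Let $\mathcal H$ be a real Hilbert space, let $R:\mathcal H\to\,]-\infty,+\infty]$ be proper, convex and lower semicontinuous, and let $F:\mathcal H\to\mathbb R$ be convex and differentiable with $L$-Lipschitz continuous gradient for some $L>0$. Put $\Phi=F+R$ and assume that $\Phi$ has at least one global minimizer. For $\gamma>0$ let $\mathrm{prox}_{\gamma R}(w)=\arg\min_{x\in\mathcal H}\{\gamma R(x)+\tfrac12\|x-w\|^2\}$. Let $p\in\,]0,1[$, $q\in[p^2,(2-p)^2]$, $r=4$ and $\gamma\in\,]0,1/L]$. Let $x_0\in\mathcal H$ be arbitrary, $x_{-1}=x_0$, $t_0=1$, and for $k\ge 1$ $$t_k=\frac{p+\sqrt{q+r\,t_{k-1}^2}}{2},\qquad a_k=\frac{t_{k-1}-1}{t_k}.$$ Let $(x_k)_{k\ge 0}$ be generated by FISTA-Mod, that is, for every $k\ge 0$, $$y_k=x_k+a_k(x_k-x_{k-1}),\qquad x_{k+1}=\mathrm{prox}_{\gamma R}\bigl(y_k-\gamma\nabla F(y_k)\bigr),$$ where $y_0=x_0$ (the value of $a_0$ is immaterial because $x_0=x_{-1}$). Then $(x_k)$ converges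 weakly to a global minimizer of $\Phi$, and $\|x_k-x_{k-1}\|=o(1/k)$ as $k\to\infty$. -/

import Mathlib

open Filter Topology Asymptotics
open scoped NNReal

noncomputable section

/-- `R : H → ]-∞, +∞]` is proper: it never takes the value `-∞` and is somewhere finite. -/
def ProperFun {H : Type*} (R : H → EReal) : Prop :=
  (∀ x, R x ≠ ⊥) ∧ ∃ x, R x ≠ ⊤

/-- Convexity of an extended-real-valued function that does not take the value `-∞`
(in `EReal` one has `0 * ⊤ = 0`). -/
def ConvexFun {H : Type*} [AddCommGroup H] [Module ℝ H] (R : H → EReal) : Prop :=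
  ∀ x y : H, ∀ a b : ℝ, 0 ≤ a → 0 ≤ b → a + b = 1 →
    R (a • x + b • y) ≤ (a : EReal) * R x + (b : EReal) * R y

/-- `x` is a global minimizer of `Φ`. -/
def IsGlobalMin {H : Type*} (Φ : H → EReal) (x : H) : Prop :=
  ∀ z, Φ x ≤ Φ z

/-- The objective `Φ = F + R`. -/
def objective {H : Type*} (F : H → ℝ) (R : H → EReal) (x : H) : EReal :=
  (F x : EReal) + R x

/-- The proximity operator `prox_{γ R} w = argmin_x (γ R x + ‖x - w‖² / 2)`. For `γ > 0` and `R`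
proper, convex and lower semicontinuous on a Hilbert space, there is exactly one minimizer. -/
def prox {H : Type*} [NormedAddCommGroup H] (γ : ℝ) (R : H → EReal) (w : H) : H :=
  Classical.epsilon fun x : H =>
    IsGlobalMin (fun z => (γ : EReal) * R z + ((1 / 2 * ‖z - w‖ ^ 2 : ℝ) : EReal)) x

/-- The sequence `t_0 = 1`, `t_k = (p + √(q + r t_{k-1}²)) / 2`. -/
def fistaT (p q r : ℝ) : ℕ → ℝ
  | 0 => 1
  | k + 1 => (p + √(q + r * fistaT p q r k ^ 2)) / 2

/-- The inertial parameter `a_k = (t_{k-1} - 1) / t_k`, `k ≥ 1`. The value `a_0` is immaterial,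
since it multiplies `x_0 - x_{-1} = 0`. -/
def fistaA (p q r : ℝ) : ℕ → ℝ
  | 0 => 0
  | k + 1 => (fistaT p q r k - 1) / fistaT p q r (k + 1)

/-- The forward-backward step `y ↦ prox_{γ R} (y - γ ∇F(y))`. -/
def forwardBackward {H : Type*} [NormedAddCommGroup H] [InnerProductSpace ℝ H] [CompleteSpace H]
    (F : H → ℝ) (R : H → EReal) (γ : ℝ) (y : H) : H :=
  prox γ R (y - γ • gradient F y)

/-- The iterates of FISTA-Mod started at `x_{-1} = x_0`: for `k ≥ 0`,
`y_k = x_k + a_k (x_k - x_{k-1})` and `x_{k+1} = prox_{γ R} (y_k - γ ∇F(y_k))`;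
in particular `y_0 = x_0`. -/
def fistaMod {H : Type*} [NormedAddCommGroup H] [InnerProductSpace ℝ H] [CompleteSpace H]
    (F : H → ℝ) (R : H → EReal) (γ p q r : ℝ) (x₀ : H) : ℕ → H
  | 0 => x₀
  | 1 => forwardBackward F R γ x₀
  | k + 2 => forwardBackward F R γ
      (fistaMod F R γ p q r x₀ (k + 1) + fistaA p q r (k + 1) •
        (fistaMod F R γ p q r x₀ (k + 1) - fistaMod F R γ p q r x₀ k))

end

/-!
The proof is a Lyapunov argument. With `r = 4` the recursion for `t` reads
`t (n+1)² - t n² = p t (n+1) + (q - p²) / 4`, so `q ≤ (2 - p)²` and `p < 1` make the classical FISTA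
condition `t (n+1)² - t (n+1) ≤ t n²` hold with a gap of order `t n` (`fistaT_mul_le_gap`), while
`t n` grows linearly.

Write `T` for the forward-backward step and `c = 1 / (2 γ)`. Convexity and the descent lemma give
`Φ (T y) + c ‖v - T y‖² ≤ Φ v + c ‖v - y‖²` for all `v` in the domain of `Φ`
(`forwardBackward_spec`). Two choices of `v` are used. Let `z` be a minimizer,
`W n = Φ (x (n+1)) - Φ z`, `D n = c ‖x (n+1) - x n‖²` and
`U n = c ‖x n + t n (x (n+1) - x n) - z‖²`.

* For `v` a convex combination of the current iterate and `z`, the energy `t² W + U` decreases, and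
  the gap makes `∑ t W` finite (`ConvexOn.inertial_step_energy_le`).
* For `v` the current iterate, the energy `t² (D + W)` decreases up to an error of order `t W`, which
  is summable; hence it converges and `∑ t D` is finite (`inertial_step_increment_le`).

Since `∑ t (D + W)` is finite and `∑ 1 / t` diverges, the limit of `t² (D + W)` is zero
(`tendsto_of_energy_estimates`). This is the rate `o(1/k)` for the increments, and it also gives
`t² W → 0`, so that `U` converges. The point `x n + t n (x (n+1) - x n)` differs from `x n` by
`t n ‖x (n+1) - x n‖ → 0`, so `‖x n - z‖` converges for every minimizer `z`. Weak cluster points are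
minimizers because the sublevel sets of `Φ` are closed and convex, and Opial's lemma
(`exists_tendsto_toWeakSpace_of_opial`) concludes.

Besides `⊤`-valued arithmetic, which is removed by restricting to the effective domain of `R`, the
existence of the proximal points has to be shown: at the points used by the algorithm the proximal
objective is bounded below in terms of the minimum of `Φ`, and strong convexity makes its sublevel
sets shrink to a point (`ConvexOn.exists_isMinOn_add_sq`).
-/

/-! ### The inertial parameters and the energy estimates -/

theorem one_le_fistaT {p q : ℝ} (hp : 0 ≤ p) (hq : p ^ 2 ≤ q) (k : ℕ) :
    1 ≤ fistaT p q 4 k := by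
  induction k with
  | zero => simp [fistaT]
  | succ k ih =>
    have h : 2 * fistaT p q 4 k ≤ √(q + 4 * fistaT p q 4 k ^ 2) :=
      Real.le_sqrt_of_sq_le (by nlinarith [sq_nonneg p])
    simp only [fistaT]
    linarith

theorem fistaT_sq_sub {p q : ℝ} (hq : p ^ 2 ≤ q) (k : ℕ) :
    fistaT p q 4 (k + 1) ^ 2 - fistaT p q 4 k ^ 2
      = p * fistaT p q 4 (k + 1) + (q - p ^ 2) / 4 := by
  have h : √(q + 4 * fistaT p q 4 k ^ 2) ^ 2 = q + 4 * fistaT p q 4 k ^ 2 :=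
    Real.sq_sqrt (by nlinarith [sq_nonneg p, sq_nonneg (fistaT p q 4 k)])
  simp only [fistaT]
  nlinarith

theorem fistaT_add_le {p q : ℝ} (hq : p ^ 2 ≤ q) (k : ℕ) :
    fistaT p q 4 k + p / 2 ≤ fistaT p q 4 (k + 1) := by
  have h : 2 * fistaT p q 4 k ≤ √(q + 4 * fistaT p q 4 k ^ 2) :=
    Real.le_sqrt_of_sq_le (by nlinarith [sq_nonneg p])
  simp only [fistaT]
  linarith

theorem fistaT_succ_le {p q : ℝ} (hp : 0 ≤ p) (hp2 : p ≤ 2) (hq : p ^ 2 ≤ q)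
    (hq2 : q ≤ (2 - p) ^ 2) (k : ℕ) : fistaT p q 4 (k + 1) ≤ fistaT p q 4 k + 1 := by
  have ht := one_le_fistaT hp hq k
  have h : √(q + 4 * fistaT p q 4 k ^ 2) ≤ (2 - p) + 2 * fistaT p q 4 k := by
    apply Real.sqrt_le_iff.2
    constructor
    · linarith
    · nlinarith [mul_nonneg (sub_nonneg.2 hp2) (zero_le_one.trans ht)]
  simp only [fistaT]
  linarith

theorem le_fistaT {p q : ℝ} (hp2 : p ≤ 2) (hq : p ^ 2 ≤ q) (k : ℕ) :
    p / 2 * (k + 1) ≤ fistaT p q 4 k := by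
  induction k with
  | zero => simp [fistaT]; linarith
  | succ k ih =>
    have := fistaT_add_le hq k
    push_cast
    linarith

theorem fistaT_le {p q : ℝ} (hp : 0 ≤ p) (hp2 : p ≤ 2) (hq : p ^ 2 ≤ q)
    (hq2 : q ≤ (2 - p) ^ 2) (k : ℕ) : fistaT p q 4 k ≤ k + 1 := by
  induction k with
  | zero => simp [fistaT]
  | succ k ih =>
    have := fistaT_succ_le hp hp2 hq hq2 k
    push_cast
    linarith

/-- The FISTA condition `t (k+1)² - t (k+1) ≤ t k²` holds with a gap of order `t k`: the left-hand
side minus the right-hand side equals `(q - p²) / 4 - (1 - p) t (k+1)`, and `q ≤ (2 - p)²` gives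
`(q - p²) / 4 ≤ 1 - p`. -/
theorem fistaT_mul_le_gap {p q : ℝ} (hp : 0 ≤ p) (hp1 : p ≤ 1) (hq : p ^ 2 ≤ q)
    (hq2 : q ≤ (2 - p) ^ 2) (k : ℕ) :
    (1 - p) * (p / 2) * fistaT p q 4 k
      ≤ fistaT p q 4 k ^ 2 - fistaT p q 4 (k + 1) ^ 2 + fistaT p q 4 (k + 1) := by
  have h1 := fistaT_sq_sub hq k
  have h2 := fistaT_add_le hq k
  have h3 := one_le_fistaT hp hq k
  have h4 : p / 2 * fistaT p q 4 k ≤ fistaT p q 4 (k + 1) - 1 := by nlinarith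
  have h5 := mul_le_mul_of_nonneg_left h4 (sub_nonneg.2 hp1)
  nlinarith

/-- A deterministic Robbins–Siegmund lemma: a nonnegative sequence that decreases up to a summable
error converges, and its drops are summable. -/
theorem summable_and_tendsto_of_add_le {e b c : ℕ → ℝ} (he : ∀ n, 0 ≤ e n) (hb : ∀ n, 0 ≤ b n)
    (hc : ∀ n, 0 ≤ c n) (hcs : Summable c) (h : ∀ n, e (n + 1) + b n ≤ e n + c n) :
    Summable b ∧ ∃ l, Tendsto e atTop (𝓝 l) := by
  have hsum : ∀ n, e n + ∑ i ∈ Finset.range n, b i ≤ e 0 + ∑ i ∈ Finset.range n, c i := by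
    intro n
    induction n with
    | zero => simp
    | succ n ih =>
      rw [Finset.sum_range_succ, Finset.sum_range_succ]
      linarith [h n]
  refine ⟨summable_of_sum_range_le (c := e 0 + ∑' i, c i) hb fun n => ?_, ?_⟩
  · linarith [hsum n, he n, hcs.sum_le_tsum (Finset.range n) fun i _ => hc i]
  -- `e n` minus the partial sums of `c` decreases and is bounded below.
  · have hanti : Antitone fun n => e n - ∑ i ∈ Finset.range n, c i := by
      refine antitone_nat_of_succ_le fun n => ?_
      rw [Finset.sum_range_succ]
      linarith [h n, hb n]
    have hbdd : BddBelow (Set.range fun n => e n - ∑ i ∈ Finset.range n, c i) := by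
      refine ⟨-∑' i, c i, ?_⟩
      rintro _ ⟨n, rfl⟩
      have := hcs.sum_le_tsum (Finset.range n) fun i _ => hc i
      have := he n
      dsimp only
      linarith
    have hlim := (tendsto_atTop_ciInf hanti hbdd).add hcs.hasSum.tendsto_sum_nat
    simp only [sub_add_cancel] at hlim
    exact ⟨_, hlim⟩

/-- A convergent nonnegative sequence that is summable against `1 / t`, where `t` grows at most
linearly, tends to zero. -/
theorem tendsto_zero_of_summable_div {e t : ℕ → ℝ} (he : ∀ n, 0 ≤ e n) (ht : ∀ n, 0 < t n)
    (htn : ∀ n : ℕ, t n ≤ n + 1) (hs : Summable fun n => e n / t n) {l : ℝ}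
    (hl : Tendsto e atTop (𝓝 l)) : Tendsto e atTop (𝓝 0) := by
  have hl0 : 0 ≤ l := ge_of_tendsto' hl he
  rcases hl0.eq_or_lt with rfl | hpos
  · exact hl
  exfalso
  -- eventually `e n ≥ l / 2`, so the harmonic series would converge
  obtain ⟨N, hN⟩ := eventually_atTop.1 (hl.eventually (lt_mem_nhds (half_lt_self hpos)))
  have hs' : Summable fun n : ℕ => (l / 2) * (1 / ((n : ℝ) + 1)) := by
    refine (summable_nat_add_iff N).1 (Summable.of_nonneg_of_le (fun n => by positivity)
      (fun n => ?_) ((summable_nat_add_iff N).2 hs))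
    rw [mul_one_div]
    exact div_le_div₀ (he _) (hN _ (Nat.le_add_left _ _)).le (ht _) (htn _)
  have h2 := (summable_mul_left_iff (half_pos hpos).ne').1 hs'
  refine Real.not_summable_one_div_natCast ((summable_nat_add_iff 1).1 ?_)
  simpa using h2

/-- The real-sequence core of the convergence proof. `W`, `D` and `U` stand for the objective gaps,
the scaled squared increments and the scaled squared distances of the extrapolated points to a
minimizer. -/
theorem tendsto_of_energy_estimates {p q : ℝ} (hp : 0 < p) (hp1 : p < 1) (hq : p ^ 2 ≤ q)
    (hq2 : q ≤ (2 - p) ^ 2) {W D U : ℕ → ℝ} (hW : ∀ n, 0 ≤ W n) (hD : ∀ n, 0 ≤ D n)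
    (hU : ∀ n, 0 ≤ U n)
    (h1 : ∀ n, fistaT p q 4 (n + 1) ^ 2 * W (n + 1) + U (n + 1)
      ≤ (fistaT p q 4 (n + 1) ^ 2 - fistaT p q 4 (n + 1)) * W n + U n)
    (h2 : ∀ n, fistaT p q 4 (n + 1) ^ 2 * (D (n + 1) + W (n + 1))
      ≤ fistaT p q 4 (n + 1) ^ 2 * W n + (fistaT p q 4 n - 1) ^ 2 * D n) :
    Tendsto (fun n => fistaT p q 4 n ^ 2 * W n) atTop (𝓝 0) ∧
    Tendsto (fun n => fistaT p q 4 n ^ 2 * D n) atTop (𝓝 0) ∧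
    ∃ l, Tendsto U atTop (𝓝 l) := by
  set t := fistaT p q 4 with ht_def
  have ht : ∀ n, 1 ≤ t n := one_le_fistaT hp.le hq
  have ht0 : ∀ n, 0 < t n := fun n => zero_lt_one.trans_le (ht n)
  have hκ : 0 < (1 - p) * (p / 2) := mul_pos (by linarith) (by linarith)
  -- the energy `t² W + U` decreases, with a drop of order `t W`
  obtain ⟨hs, lA, hlA⟩ := summable_and_tendsto_of_add_le
    (e := fun n => t n ^ 2 * W n + U n) (b := fun n => (1 - p) * (p / 2) * (t n * W n))
    (c := fun _ => 0)
    (fun n => add_nonneg (mul_nonneg (sq_nonneg _) (hW n)) (hU n))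
    (fun n => mul_nonneg hκ.le (mul_nonneg (ht0 n).le (hW n))) (fun _ => le_rfl) summable_zero
    (fun n => by
      have := mul_le_mul_of_nonneg_right (fistaT_mul_le_gap hp.le hp1.le hq hq2 n) (hW n)
      have := h1 n
      nlinarith)
  have hsW : Summable fun n => t n * W n := (summable_mul_left_iff hκ.ne').1 hs
  -- the energy `t² (D + W)` is decreasing up to a summable error, with a drop of order `t D`
  obtain ⟨hsD, lE, hlE⟩ := summable_and_tendsto_of_add_le
    (e := fun n => t n ^ 2 * (D n + W n)) (b := fun n => t n * D n)
    (c := fun n => 2 * (t n * W n))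
    (fun n => mul_nonneg (sq_nonneg _) (add_nonneg (hD n) (hW n)))
    (fun n => mul_nonneg (ht0 n).le (hD n))
    (fun n => mul_nonneg zero_le_two (mul_nonneg (ht0 n).le (hW n))) (hsW.mul_left 2)
    (fun n => by
      have hgap := fistaT_mul_le_gap hp.le hp1.le hq hq2 n
      have hsucc := fistaT_succ_le hp.le (by linarith) hq hq2 n
      have hκt : 0 ≤ (1 - p) * (p / 2) * t n := mul_nonneg hκ.le (ht0 n).le
      have hinc : t (n + 1) ^ 2 ≤ t n ^ 2 + 2 * t n := by
        linarith [ht n]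
      have hW' := mul_le_mul_of_nonneg_right hinc (hW n)
      have hD' := mul_le_mul_of_nonneg_right (ht n) (hD n)
      have := h2 n
      nlinarith)
  have hE0 : Tendsto (fun n => t n ^ 2 * (D n + W n)) atTop (𝓝 0) := by
    refine tendsto_zero_of_summable_div
      (fun n => mul_nonneg (sq_nonneg _) (add_nonneg (hD n) (hW n))) ht0
      (fistaT_le hp.le (by linarith) hq hq2) ((hsD.add hsW).congr fun n => ?_) hlE
    have := (ht0 n).ne'
    field_simp
  have hW0 : Tendsto (fun n => t n ^ 2 * W n) atTop (𝓝 0) :=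
    squeeze_zero (fun n => mul_nonneg (sq_nonneg _) (hW n))
      (fun n => mul_le_mul_of_nonneg_left (by linarith [hD n]) (sq_nonneg _)) hE0
  refine ⟨hW0, squeeze_zero (fun n => mul_nonneg (sq_nonneg _) (hD n))
      (fun n => mul_le_mul_of_nonneg_left (by linarith [hW n]) (sq_nonneg _)) hE0, lA, ?_⟩
  simpa using hlA.sub hW0

/-! ### Weak convergence -/

/-- Weak convergence in a real Hilbert space, tested by inner products. -/
theorem tendsto_toWeakSpace_iff_inner {H ι : Type*} [NormedAddCommGroup H] [InnerProductSpace ℝ H]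
    [CompleteSpace H] {l : Filter ι} {x : ι → H} {y : H} :
    Tendsto (fun i => toWeakSpace ℝ H (x i)) l (𝓝 (toWeakSpace ℝ H y)) ↔
      ∀ v : H, Tendsto (fun i => inner ℝ v (x i)) l (𝓝 (inner ℝ v y)) := by
  have h := WeakBilin.tendsto_iff_forall_eval_tendsto (l := l) (topDualPairing ℝ H).flip
    (f := fun i => toWeakSpace ℝ H (x i)) (x := toWeakSpace ℝ H y) (by
      intro a b hab
      refine ext_inner_left ℝ fun v => ?_
      exact DFunLike.congr_fun hab (InnerProductSpace.toDual ℝ H v))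
  refine h.trans ⟨fun h v => h (InnerProductSpace.toDual ℝ H v), fun h v => ?_⟩
  have := h ((InnerProductSpace.toDual ℝ H).symm v)
  simp only [InnerProductSpace.toDual_symm_apply] at this
  exact this

/-- Bounded families in a Hilbert space have weak limits along ultrafilters. -/
theorem exists_tendsto_toWeakSpace_of_bounded {H ι : Type*} [NormedAddCommGroup H]
    [InnerProductSpace ℝ H] [CompleteSpace H] (𝒰 : Ultrafilter ι) {x : ι → H} {C : ℝ}
    (hx : ∀ i, ‖x i‖ ≤ C) :
    ∃ y : H, Tendsto (fun i => toWeakSpace ℝ H (x i)) 𝒰 (𝓝 (toWeakSpace ℝ H y)) := by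
  let φ : ι → WeakDual ℝ H := fun i =>
    StrongDual.toWeakDual (InnerProductSpace.toDual ℝ H (x i))
  have hcomp : IsCompact (WeakDual.toStrongDual ⁻¹' Metric.closedBall (0 : StrongDual ℝ H) C) :=
    WeakDual.isCompact_closedBall 0 C
  obtain ⟨ψ, -, hψ⟩ := hcomp.ultrafilter_le_nhds (𝒰.map φ) (by
    refine le_principal_iff.2 (Filter.mem_map.2 (Filter.univ_mem' fun i => ?_))
    have : ‖InnerProductSpace.toDual ℝ H (x i)‖ ≤ C := by simpa using hx i
    simpa [φ] using this)
  refine ⟨(InnerProductSpace.toDual ℝ H).symm (WeakDual.toStrongDual ψ),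
    tendsto_toWeakSpace_iff_inner.2 fun v => ?_⟩
  have h : Tendsto (fun i => φ i v) 𝒰 (𝓝 (ψ v)) :=
    ((WeakDual.eval_continuous v).tendsto ψ).comp hψ
  have e1 : ∀ i, φ i v = inner ℝ v (x i) := fun i => by
    rw [real_inner_comm]; rfl
  have e2 : ψ v = inner ℝ v ((InnerProductSpace.toDual ℝ H).symm (WeakDual.toStrongDual ψ)) := by
    rw [real_inner_comm, InnerProductSpace.toDual_symm_apply]; rfl
  simpa only [e1, e2] using h

/-- Closed convex sets are weakly closed. -/
theorem mem_of_tendsto_toWeakSpace {H ι : Type*} [NormedAddCommGroup H] [InnerProductSpace ℝ H]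
    {l : Filter ι} [l.NeBot] {x : ι → H} {y : H} {s : Set H} (hs : Convex ℝ s)
    (hsc : IsClosed s) (hx : ∀ᶠ i in l, x i ∈ s)
    (h : Tendsto (fun i => toWeakSpace ℝ H (x i)) l (𝓝 (toWeakSpace ℝ H y))) : y ∈ s := by
  have hcl : toWeakSpace ℝ H y ∈ closure (toWeakSpace ℝ H '' s) :=
    mem_closure_of_tendsto h (hx.mono fun i hi => Set.mem_image_of_mem _ hi)
  rw [← hs.toWeakSpace_closure ℝ, hsc.closure_eq] at hcl
  obtain ⟨z, hz, hzy⟩ := hcl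
  rwa [← (toWeakSpace ℝ H).injective hzy]

/-- **Opial's lemma**: if the distances to all points of `S` converge and all weak cluster points
belong to `S`, then the sequence converges weakly to a point of `S`. Cluster points are taken along
ultrafilters, which spares the extraction of subsequences. -/
theorem exists_tendsto_toWeakSpace_of_opial {H : Type*} [NormedAddCommGroup H]
    [InnerProductSpace ℝ H] [CompleteSpace H] {S : Set H} (hS : S.Nonempty) {x : ℕ → H}
    (hdist : ∀ z ∈ S, ∃ l, Tendsto (fun n => ‖x n - z‖) atTop (𝓝 l))
    (hcluster : ∀ (𝒰 : Ultrafilter ℕ) (y : H), (𝒰 : Filter ℕ) ≤ atTop →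
      Tendsto (fun n => toWeakSpace ℝ H (x n)) 𝒰 (𝓝 (toWeakSpace ℝ H y)) → y ∈ S) :
    ∃ y ∈ S, Tendsto (fun n => toWeakSpace ℝ H (x n)) atTop (𝓝 (toWeakSpace ℝ H y)) := by
  obtain ⟨z, hz⟩ := hS
  obtain ⟨l, hl⟩ := hdist z hz
  obtain ⟨C, hC⟩ := hl.bddAbove_range
  have hbd : ∀ n, ‖x n‖ ≤ C + ‖z‖ := fun n => by
    have h1 : ‖x n - z‖ ≤ C := hC ⟨n, rfl⟩
    have h2 := norm_add_le (x n - z) z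
    rw [sub_add_cancel] at h2
    linarith
  have hex := fun 𝒰 : Ultrafilter ℕ => exists_tendsto_toWeakSpace_of_bounded 𝒰 hbd
  obtain ⟨y, hy⟩ := hex (Ultrafilter.of atTop)
  have hyS := hcluster _ y (Ultrafilter.of_le _) hy
  refine ⟨y, hyS, tendsto_iff_ultrafilter _ _ _ |>.2 fun 𝒰 h𝒰 => ?_⟩
  obtain ⟨y', hy'⟩ := hex 𝒰
  have hyS' := hcluster _ y' h𝒰 hy'
  -- `⟨y - y', x n⟩` converges along `atTop`, since it is an affine function of
  -- `‖x n - y‖² - ‖x n - y'‖²`; its limits along the two ultrafilters agree.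
  obtain ⟨a, ha⟩ := hdist y hyS
  obtain ⟨b, hb⟩ := hdist y' hyS'
  have hlim : Tendsto (fun n => inner ℝ (y - y') (x n)) atTop
      (𝓝 ((b ^ 2 - a ^ 2 + ‖y‖ ^ 2 - ‖y'‖ ^ 2) / 2)) := by
    refine (((((hb.pow 2).sub (ha.pow 2)).add_const _).sub_const _).div_const 2).congr fun n => ?_
    rw [norm_sub_sq_real, norm_sub_sq_real, inner_sub_left, real_inner_comm y, real_inner_comm y']
    ring
  have e1 := tendsto_nhds_unique (tendsto_toWeakSpace_iff_inner.1 hy (y - y'))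
    (hlim.mono_left (Ultrafilter.of_le _))
  have e2 := tendsto_nhds_unique (tendsto_toWeakSpace_iff_inner.1 hy' (y - y'))
    (hlim.mono_left h𝒰)
  have h0 : inner ℝ (y - y') (y - y') = 0 := by
    rw [inner_sub_right, e1, e2, sub_self]
  rw [sub_eq_zero.1 (inner_self_eq_zero.1 h0)]
  exact hy'

/-! ### Convex and smooth functions -/

theorem norm_sq_convex_combination {H : Type*} [NormedAddCommGroup H] [InnerProductSpace ℝ H]
    (x z w : H) (s : ℝ) :
    ‖(1 - s) • z + s • x - w‖ ^ 2
      = (1 - s) * ‖z - w‖ ^ 2 + s * ‖x - w‖ ^ 2 - s * (1 - s) * ‖x - z‖ ^ 2 := by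
  have e1 : (1 - s) • z + s • x - w = (1 - s) • (z - w) + s • (x - w) := by module
  have e2 : x - z = (x - w) - (z - w) := by abel
  rw [e1, e2, norm_add_sq_real, norm_sub_sq_real (x - w), norm_smul, norm_smul, mul_pow, mul_pow,
    Real.norm_eq_abs, Real.norm_eq_abs, sq_abs, sq_abs, inner_smul_left, inner_smul_right,
    real_inner_comm (x - w)]
  simp only [conj_trivial]
  ring

/-- Quadratic growth away from a minimizer `z` of `f + c ‖· - w‖²`: compare `z` with
`(1 - s) z + s x`, divide by `s` and let `s` tend to zero. -/
theorem ConvexOn.add_sq_le_of_isMinOn {H : Type*} [NormedAddCommGroup H] [InnerProductSpace ℝ H]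
    {D : Set H} {f : H → ℝ} (hf : ConvexOn ℝ D f) {c : ℝ} {w z : H} (hz : z ∈ D)
    (hmin : ∀ x ∈ D, f z + c * ‖z - w‖ ^ 2 ≤ f x + c * ‖x - w‖ ^ 2) {x : H} (hx : x ∈ D) :
    f z + c * ‖z - w‖ ^ 2 + c * ‖x - z‖ ^ 2 ≤ f x + c * ‖x - w‖ ^ 2 := by
  have key : ∀ s ∈ Set.Ioo (0 : ℝ) 1, f z + c * ‖z - w‖ ^ 2 + c * (1 - s) * ‖x - z‖ ^ 2
      ≤ f x + c * ‖x - w‖ ^ 2 := by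
    rintro s ⟨hs0, hs1⟩
    have h1 := hmin _ (hf.1 hz hx (sub_nonneg.2 hs1.le) hs0.le (by ring))
    have h2 := hf.2 hz hx (sub_nonneg.2 hs1.le) hs0.le (by ring)
    rw [norm_sq_convex_combination] at h1
    simp only [smul_eq_mul] at h2
    refine le_of_mul_le_mul_left ?_ hs0
    nlinarith
  have hlim : Tendsto (fun s : ℝ => f z + c * ‖z - w‖ ^ 2 + c * (1 - s) * ‖x - z‖ ^ 2)
      (𝓝[>] 0) (𝓝 (f z + c * ‖z - w‖ ^ 2 + c * (1 - 0) * ‖x - z‖ ^ 2)) :=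
    Tendsto.mono_left (Continuous.tendsto (by fun_prop) 0) nhdsWithin_le_nhds
  have := le_of_tendsto hlim
    (eventually_of_mem (Ioo_mem_nhdsGT zero_lt_one) fun s hs => key s hs)
  simpa using this

/-- Strongly convex lower semicontinuous functions attain their infimum; `hclosed` encodes lower
semicontinuity. The sublevel sets for the levels `m + 1 / (n + 1)`, with `m` the infimum, are
closed, nonempty and, by strong convexity, of diameter tending to zero. -/
theorem ConvexOn.exists_isMinOn_add_sq {H : Type*} [NormedAddCommGroup H] [InnerProductSpace ℝ H]
    [CompleteSpace H] {D : Set H} {f : H → ℝ} (hf : ConvexOn ℝ D f) (hD : D.Nonempty)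
    (hclosed : ∀ g : H → ℝ, Continuous g → IsClosed {x | x ∈ D ∧ f x ≤ g x}) {c : ℝ} (hc : 0 < c)
    {w : H} (hbdd : ∃ m, ∀ x ∈ D, m ≤ f x + c * ‖x - w‖ ^ 2) :
    ∃ z ∈ D, ∀ x ∈ D, f z + c * ‖z - w‖ ^ 2 ≤ f x + c * ‖x - w‖ ^ 2 := by
  set G : H → ℝ := fun x => f x + c * ‖x - w‖ ^ 2 with hG
  obtain ⟨b, hb⟩ := hbdd
  have hB : BddBelow (G '' D) := ⟨b, by rintro _ ⟨x, hx, rfl⟩; exact hb x hx⟩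
  set m := sInf (G '' D) with hm
  have hmle : ∀ x ∈ D, m ≤ G x := fun x hx => csInf_le hB ⟨x, hx, rfl⟩
  let S : ℕ → Set H := fun n => {x | x ∈ D ∧ f x ≤ m + 1 / ((n : ℝ) + 1) - c * ‖x - w‖ ^ 2}
  have hSn : ∀ n, (S n).Nonempty := fun n => by
    obtain ⟨_, ⟨x, hx, rfl⟩, hlt⟩ := exists_lt_of_csInf_lt (hD.image G)
      (show sInf (G '' D) < m + 1 / ((n : ℝ) + 1) from lt_add_of_pos_right _ (by positivity))
    exact ⟨x, hx, by simp only [hG] at hlt; linarith⟩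
  have hSc : ∀ n, IsClosed (S n) := fun n => hclosed _ (by fun_prop)
  have hSanti : Antitone S := fun i j hij x hx => by
    refine ⟨hx.1, hx.2.trans ?_⟩
    have := Nat.one_div_le_one_div (α := ℝ) hij
    linarith
  -- the midpoint inequality bounds the distance of two points of `S n`
  have hSd : ∀ n, ∀ x ∈ S n, ∀ y ∈ S n, dist x y ≤ √(4 / c * (1 / ((n : ℝ) + 1))) := by
    intro n x hx y hy
    have ha : (0 : ℝ) ≤ 1 - 1 / 2 := by norm_num
    have hb : (0 : ℝ) ≤ 1 / 2 := by norm_num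
    have hab : (1 - 1 / 2 : ℝ) + 1 / 2 = 1 := by norm_num
    have h1 := hmle _ (hf.1 hx.1 hy.1 ha hb hab)
    have h2 := hf.2 hx.1 hy.1 ha hb hab
    have hx2 := hx.2
    have hy2 := hy.2
    simp only [hG, norm_sq_convex_combination] at h1
    simp only [smul_eq_mul] at h2
    refine Real.le_sqrt_of_sq_le ?_
    rw [dist_comm, dist_eq_norm, div_mul_eq_mul_div, le_div_iff₀ hc]
    linarith
  have hinter : (⋂ n, S n).Nonempty := by
    refine Metric.nonempty_iInter_of_nonempty_biInter hSc (fun n => ?_) (fun N => ?_) ?_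
    · exact Metric.isBounded_iff.2 ⟨_, fun x hx y hy => hSd n x hx y hy⟩
    · obtain ⟨x, hx⟩ := hSn N
      exact ⟨x, Set.mem_iInter₂.2 fun n hn => hSanti hn hx⟩
    · refine squeeze_zero (fun n => Metric.diam_nonneg)
        (fun n => Metric.diam_le_of_forall_dist_le (Real.sqrt_nonneg _) (hSd n)) ?_
      have := (tendsto_one_div_add_atTop_nhds_zero_nat (𝕜 := ℝ)).const_mul (4 / c)
      simpa [Function.comp_def] using (Real.continuous_sqrt.tendsto _).comp this
  obtain ⟨z, hz⟩ := hinter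
  rw [Set.mem_iInter] at hz
  refine ⟨z, (hz 0).1, fun x hx => ?_⟩
  have h3 : G z ≤ m + 0 := by
    refine ge_of_tendsto' ((tendsto_one_div_add_atTop_nhds_zero_nat (𝕜 := ℝ)).const_add m)
      fun n => ?_
    have := (hz n).2
    simp only [hG]
    linarith
  exact (h3.trans_eq (add_zero m)).trans (hmle x hx)

theorem hasDerivAt_comp_add_smul {H : Type*} [NormedAddCommGroup H] [InnerProductSpace ℝ H]
    [CompleteSpace H] {F : H → ℝ} (hF : Differentiable ℝ F) (y d : H) (s : ℝ) :
    HasDerivAt (fun s : ℝ => F (y + s • d)) (inner ℝ (gradient F (y + s • d)) d) s := by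
  have h1 : HasDerivAt (fun s : ℝ => y + s • d) d s := by
    simpa using ((hasDerivAt_id s).smul_const d).const_add y
  have h2 := (hF (y + s • d)).hasFDerivAt.comp_hasDerivAt s h1
  rwa [← inner_gradient_left] at h2

/-- The gradient inequality of a convex function. -/
theorem ConvexOn.add_inner_gradient_le {H : Type*} [NormedAddCommGroup H] [InnerProductSpace ℝ H]
    [CompleteSpace H] {F : H → ℝ} (hc : ConvexOn ℝ Set.univ F) (hF : Differentiable ℝ F) (y x : H) :
    F y + inner ℝ (gradient F y) (x - y) ≤ F x := by
  have h := hasDerivAt_comp_add_smul hF y (x - y) 0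
  simp only [zero_smul, add_zero] at h
  have hlim := h.tendsto_slope_zero_right
  have := le_of_tendsto hlim (eventually_of_mem (Ioo_mem_nhdsGT zero_lt_one)
    (fun s (hs : s ∈ Set.Ioo (0 : ℝ) 1) => (?_ : _ ≤ F x - F y)))
  · linarith
  · have h2 := hc.2 (Set.mem_univ y) (Set.mem_univ x) (sub_nonneg.2 hs.2.le) hs.1.le (by ring)
    have e : (1 - s) • y + s • x = y + s • (x - y) := by module
    rw [e] at h2
    simp only [smul_eq_mul, zero_add, zero_smul, add_zero] at h2 ⊢
    rw [inv_mul_le_iff₀ hs.1]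
    linarith

/-- The **descent lemma**: the difference of the two sides is monotone along the segment from `y`
to `z`. -/
theorem LipschitzWith.le_add_inner_gradient_add_sq {H : Type*} [NormedAddCommGroup H]
    [InnerProductSpace ℝ H] [CompleteSpace H] {F : H → ℝ} {L : ℝ≥0}
    (hL : LipschitzWith L (gradient F)) (hF : Differentiable ℝ F) (y z : H) :
    F z ≤ F y + inner ℝ (gradient F y) (z - y) + L / 2 * ‖z - y‖ ^ 2 := by
  set d := z - y with hd
  have hder : ∀ s : ℝ, HasDerivAt
      (fun s : ℝ => F (y + s • d) - s * inner ℝ (gradient F y) d - s ^ 2 * (L / 2 * ‖d‖ ^ 2))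
      (inner ℝ (gradient F (y + s • d)) d - inner ℝ (gradient F y) d - s * (L * ‖d‖ ^ 2)) s := by
    intro s
    have h := ((hasDerivAt_comp_add_smul hF y d s).sub
      ((hasDerivAt_id s).mul_const (inner ℝ (gradient F y) d))).sub
      ((hasDerivAt_pow 2 s).mul_const (L / 2 * ‖d‖ ^ 2))
    refine h.congr_deriv ?_
    push_cast
    ring
  have hanti : AntitoneOn
      (fun s : ℝ => F (y + s • d) - s * inner ℝ (gradient F y) d - s ^ 2 * (L / 2 * ‖d‖ ^ 2))
      (Set.Ici 0) := by
    refine antitoneOn_of_deriv_nonpos (convex_Ici 0)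
      (fun s _ => (hder s).continuousAt.continuousWithinAt)
      (fun s _ => (hder s).differentiableAt.differentiableWithinAt) fun s hs => ?_
    rw [interior_Ici] at hs
    rw [(hder s).deriv, ← inner_sub_left]
    have h1 := real_inner_le_norm (gradient F (y + s • d) - gradient F y) d
    have h2 := hL.dist_le_mul (y + s • d) y
    rw [dist_eq_norm, dist_eq_norm, add_sub_cancel_left, norm_smul, Real.norm_eq_abs,
      abs_of_pos hs] at h2
    have h3 := mul_le_mul_of_nonneg_right h2 (norm_nonneg d)
    nlinarith
  have h := hanti (Set.mem_Ici.2 le_rfl) (Set.mem_Ici.2 zero_le_one) zero_le_one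
  have hz : y + (1 : ℝ) • d = z := by rw [one_smul, hd]; abel
  simp only [hz, zero_smul, add_zero] at h
  linarith

/-! ### Extended-real-valued functions and the proximity operator -/

/-- The effective domain of an extended-real-valued function, for functions that avoid `⊥`. -/
def effDomain {H : Type*} (R : H → EReal) : Set H := {x | R x ≠ ⊤}

theorem ProperFun.coe_toReal {H : Type*} {R : H → EReal} (hR : ProperFun R) {x : H}
    (hx : x ∈ effDomain R) : ((R x).toReal : EReal) = R x :=
  EReal.coe_toReal hx (hR.1 x)

theorem ConvexFun.convexOn_toReal {H : Type*} [AddCommGroup H] [Module ℝ H] {R : H → EReal}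
    (hc : ConvexFun R) (hR : ProperFun R) : ConvexOn ℝ (effDomain R) fun x => (R x).toReal := by
  have key : ∀ x ∈ effDomain R, ∀ y ∈ effDomain R, ∀ a b : ℝ, 0 ≤ a → 0 ≤ b → a + b = 1 →
      R (a • x + b • y) ≤ ((a * (R x).toReal + b * (R y).toReal : ℝ) : EReal) := by
    intro x hx y hy a b ha hb hab
    have h := hc x y a b ha hb hab
    rw [← hR.coe_toReal hx, ← hR.coe_toReal hy] at h
    exact_mod_cast h
  have hconv : Convex ℝ (effDomain R) := fun x hx y hy a b ha hb hab =>
    ((key x hx y hy a b ha hb hab).trans_lt (EReal.coe_lt_top _)).ne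
  refine ⟨hconv, fun x hx y hy a b ha hb hab => ?_⟩
  have h := key x hx y hy a b ha hb hab
  rw [← hR.coe_toReal (hconv hx hy ha hb hab)] at h
  exact_mod_cast h

theorem ProperFun.isClosed_toReal_le {H : Type*} [TopologicalSpace H] {R : H → EReal}
    (hR : ProperFun R) (hlsc : LowerSemicontinuous R) {g : H → ℝ} (hg : Continuous g) :
    IsClosed {x | x ∈ effDomain R ∧ (R x).toReal ≤ g x} := by
  have h : IsClosed ((fun x => (x, (g x : EReal))) ⁻¹' {p : H × EReal | R p.1 ≤ p.2}) :=
    (lowerSemicontinuous_iff_isClosed_epigraph.1 hlsc).preimage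
      (continuous_id.prodMk (continuous_coe_real_ereal.comp hg))
  convert h using 1
  ext x
  constructor
  · rintro ⟨hx, hle⟩
    change R x ≤ (g x : EReal)
    rw [← hR.coe_toReal hx]
    exact_mod_cast hle
  · intro (hle : R x ≤ (g x : EReal))
    have hx : x ∈ effDomain R := (hle.trans_lt (EReal.coe_lt_top _)).ne
    refine ⟨hx, ?_⟩
    rw [← hR.coe_toReal hx] at hle
    exact_mod_cast hle

/-- Minimizing `a R + g`, with `a > 0` and `g` real-valued, amounts to minimizing the real-valued
function `a R + g` over the effective domain of `R`. -/
theorem ProperFun.isGlobalMin_iff {H : Type*} {R : H → EReal} (hR : ProperFun R) {Ψ : H → EReal}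
    {a : ℝ} (ha : 0 < a) {g : H → ℝ} (hΨ : ∀ x, Ψ x = (a : EReal) * R x + (g x : EReal)) {x : H} :
    IsGlobalMin Ψ x ↔
      x ∈ effDomain R ∧ ∀ y ∈ effDomain R, a * (R x).toReal + g x ≤ a * (R y).toReal + g y := by
  have hcoe : ∀ y ∈ effDomain R, Ψ y = ((a * (R y).toReal + g y : ℝ) : EReal) := fun y hy => by
    rw [hΨ, ← hR.coe_toReal hy]
    norm_cast
  have htop : ∀ y ∉ effDomain R, Ψ y = ⊤ := fun y hy => by
    have : R y = ⊤ := not_not.1 hy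
    rw [hΨ, this, EReal.coe_mul_top_of_pos ha, EReal.top_add_coe]
  constructor
  · intro h
    have hx : x ∈ effDomain R := by
      by_contra hx
      obtain ⟨y, hy⟩ := hR.2
      have hle := h y
      rw [htop x hx, hcoe y hy] at hle
      exact absurd hle (EReal.coe_lt_top _).not_ge
    refine ⟨hx, fun y hy => ?_⟩
    have hle := h y
    rw [hcoe x hx, hcoe y hy] at hle
    exact_mod_cast hle
  · rintro ⟨hx, h⟩ y
    by_cases hy : y ∈ effDomain R
    · rw [hcoe x hx, hcoe y hy]
      exact_mod_cast h y hy
    · rw [htop y hy]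
      exact le_top

theorem ProperFun.isGlobalMin_objective_iff {H : Type*} {F : H → ℝ} {R : H → EReal}
    (hR : ProperFun R) {x : H} :
    IsGlobalMin (objective F R) x ↔
      x ∈ effDomain R ∧ ∀ y ∈ effDomain R, F x + (R x).toReal ≤ F y + (R y).toReal := by
  rw [hR.isGlobalMin_iff one_pos (g := F)
    (fun x => by rw [objective, EReal.coe_one, one_mul, add_comm])]
  simp only [one_mul, add_comm (F _)]

/-- `prox γ R w` is the minimizer of `R + ‖· - w‖² / (2γ)`, as soon as this function is bounded
below. -/
theorem ProperFun.prox_spec {H : Type*} [NormedAddCommGroup H] [InnerProductSpace ℝ H]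
    [CompleteSpace H] {R : H → EReal} (hR : ProperFun R) (hc : ConvexFun R)
    (hlsc : LowerSemicontinuous R) {γ : ℝ} (hγ : 0 < γ) {w : H}
    (hbdd : ∃ m, ∀ x ∈ effDomain R, m ≤ (R x).toReal + 1 / (2 * γ) * ‖x - w‖ ^ 2) :
    prox γ R w ∈ effDomain R ∧ ∀ x ∈ effDomain R,
      (R (prox γ R w)).toReal + 1 / (2 * γ) * ‖prox γ R w - w‖ ^ 2
        ≤ (R x).toReal + 1 / (2 * γ) * ‖x - w‖ ^ 2 := by
  have hscale : ∀ r s : ℝ, γ * r + 1 / 2 * s = γ * (r + 1 / (2 * γ) * s) := fun r s => by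
    field_simp
  have hiff : ∀ z, IsGlobalMin
      (fun x => (γ : EReal) * R x + ((1 / 2 * ‖x - w‖ ^ 2 : ℝ) : EReal)) z ↔
      z ∈ effDomain R ∧ ∀ x ∈ effDomain R, (R z).toReal + 1 / (2 * γ) * ‖z - w‖ ^ 2
        ≤ (R x).toReal + 1 / (2 * γ) * ‖x - w‖ ^ 2 := fun z => by
    rw [hR.isGlobalMin_iff hγ (g := fun x => 1 / 2 * ‖x - w‖ ^ 2) fun _ => rfl]
    simp only [hscale, mul_le_mul_iff_right₀ hγ]
  obtain ⟨z, hz⟩ := (hc.convexOn_toReal hR).exists_isMinOn_add_sq hR.2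
    (fun g hg => hR.isClosed_toReal_le hlsc hg) (show 0 < 1 / (2 * γ) by positivity) hbdd
  exact (hiff _).1 (Classical.epsilon_spec ⟨z, (hiff z).2 hz⟩)

/-- The forward-backward point lies in the domain of `R` and satisfies the three-point inequality
`Φ (T y) + ‖x - T y‖² / (2γ) ≤ Φ x + ‖x - y‖² / (2γ)`, with `Φ = F + R`. -/
theorem forwardBackward_spec {H : Type*} [NormedAddCommGroup H] [InnerProductSpace ℝ H]
    [CompleteSpace H] {F : H → ℝ} {R : H → EReal} {L : ℝ≥0} {γ : ℝ} (hR : ProperFun R)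
    (hRc : ConvexFun R) (hlsc : LowerSemicontinuous R) (hFc : ConvexOn ℝ Set.univ F)
    (hF : Differentiable ℝ F) (hlip : LipschitzWith L (gradient F)) (hL : 0 < L)
    (hmin : ∃ z, IsGlobalMin (objective F R) z) (hγ : 0 < γ) (hγL : γ ≤ 1 / (L : ℝ)) (y : H) :
    forwardBackward F R γ y ∈ effDomain R ∧ ∀ x ∈ effDomain R,
      F (forwardBackward F R γ y) + (R (forwardBackward F R γ y)).toReal
          + 1 / (2 * γ) * ‖x - forwardBackward F R γ y‖ ^ 2
        ≤ F x + (R x).toReal + 1 / (2 * γ) * ‖x - y‖ ^ 2 := by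
  have hL' : (0 : ℝ) < L := hL
  have hLγ : (L : ℝ) / 2 ≤ 1 / (2 * γ) := by
    rw [le_div_iff₀ hL'] at hγL
    rw [div_le_div_iff₀ two_pos (by positivity)]
    linarith
  set g := gradient F y with hg
  have hdesc : ∀ x, F x ≤ F y + inner ℝ g (x - y) + 1 / (2 * γ) * ‖x - y‖ ^ 2 := fun x =>
    (hlip.le_add_inner_gradient_add_sq hF y x).trans
      (by linarith [mul_le_mul_of_nonneg_right hLγ (sq_nonneg ‖x - y‖)])
  have hexp : ∀ x, 1 / (2 * γ) * ‖x - (y - γ • g)‖ ^ 2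
      = 1 / (2 * γ) * ‖x - y‖ ^ 2 + inner ℝ g (x - y) + γ / 2 * ‖g‖ ^ 2 := fun x => by
    rw [sub_sub_eq_add_sub, add_sub_right_comm, norm_add_sq_real, inner_smul_right, norm_smul,
      Real.norm_eq_abs, mul_pow, sq_abs, real_inner_comm]
    field_simp
  -- by the descent lemma, the proximal objective dominates `F + R` up to a constant
  have hbdd : ∃ m, ∀ x ∈ effDomain R,
      m ≤ (R x).toReal + 1 / (2 * γ) * ‖x - (y - γ • g)‖ ^ 2 := by
    obtain ⟨z, hz⟩ := hmin
    refine ⟨F z + (R z).toReal - F y + γ / 2 * ‖g‖ ^ 2, fun x hx => ?_⟩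
    rw [hexp]
    linarith [(hR.isGlobalMin_objective_iff.1 hz).2 x hx, hdesc x]
  obtain ⟨hmem, hle⟩ := hR.prox_spec hRc hlsc hγ hbdd
  refine ⟨hmem, fun x hx => ?_⟩
  have h := (hRc.convexOn_toReal hR).add_sq_le_of_isMinOn hmem hle hx
  rw [hexp, hexp] at h
  have h1 := hdesc (prox γ R (y - γ • g))
  have h2 := hFc.add_inner_gradient_le hF y x
  rw [← hg] at h2
  simp only [forwardBackward, ← hg]
  linarith

/-! ### Convergence of the iterates -/

/-- One inertial step, tested against the convex combination `(1 - 1 / t) x₁ + (1 / t) z`. -/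
theorem ConvexOn.inertial_step_energy_le {H : Type*} [NormedAddCommGroup H] [InnerProductSpace ℝ H]
    {D : Set H} {Φ : H → ℝ} (hΦ : ConvexOn ℝ D Φ) {c t τ : ℝ} (ht : 1 ≤ t) {x₀ x₁ x₂ z : H}
    (hx₁ : x₁ ∈ D) (hz : z ∈ D)
    (hstep : ∀ v ∈ D, Φ x₂ + c * ‖v - x₂‖ ^ 2
      ≤ Φ v + c * ‖v - (x₁ + ((τ - 1) / t) • (x₁ - x₀))‖ ^ 2) :
    t ^ 2 * (Φ x₂ - Φ z) + c * ‖x₁ + t • (x₂ - x₁) - z‖ ^ 2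
      ≤ (t ^ 2 - t) * (Φ x₁ - Φ z) + c * ‖x₀ + τ • (x₁ - x₀) - z‖ ^ 2 := by
  have ht0 : 0 < t := zero_lt_one.trans_le ht
  have hs0 : 0 ≤ 1 / t := by positivity
  have hs1 : 0 ≤ 1 - 1 / t := sub_nonneg.2 ((div_le_one ht0).2 ht)
  have h1 := hstep _ (hΦ.1 hx₁ hz hs1 hs0 (by ring))
  have h2 := hΦ.2 hx₁ hz hs1 hs0 (by ring)
  have e1 : (1 - 1 / t) • x₁ + (1 / t) • z - x₂ = (-(1 / t)) • (x₁ + t • (x₂ - x₁) - z) := by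
    match_scalars <;> field_simp
    ring
  have e2 : (1 - 1 / t) • x₁ + (1 / t) • z - (x₁ + ((τ - 1) / t) • (x₁ - x₀))
      = (-(1 / t)) • (x₀ + τ • (x₁ - x₀) - z) := by
    match_scalars <;> field_simp <;> ring
  rw [e1, e2, norm_smul, norm_smul, mul_pow, mul_pow, Real.norm_eq_abs, sq_abs] at h1
  simp only [smul_eq_mul] at h2
  have h3 := mul_le_mul_of_nonneg_left
    (h1.trans (add_le_add_left h2 _)) (sq_nonneg t)
  have e3 : ∀ a b : ℝ, t ^ 2 * (a + c * ((-(1 / t)) ^ 2 * b)) = t ^ 2 * a + c * b := fun a b => by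
    field_simp
  have e4 : t ^ 2 * ((1 - 1 / t) * Φ x₁ + 1 / t * Φ z) = (t ^ 2 - t) * Φ x₁ + t * Φ z := by
    field_simp
  rw [e3, e3, e4] at h3
  linarith

/-- One inertial step, tested against the current iterate `x₁`. -/
theorem inertial_step_increment_le {H : Type*} [NormedAddCommGroup H] [InnerProductSpace ℝ H]
    {D : Set H} {Φ : H → ℝ} {c t τ : ℝ} (ht : 0 < t) {x₀ x₁ x₂ : H} (m : ℝ) (hx₁ : x₁ ∈ D)
    (hstep : ∀ v ∈ D, Φ x₂ + c * ‖v - x₂‖ ^ 2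
      ≤ Φ v + c * ‖v - (x₁ + ((τ - 1) / t) • (x₁ - x₀))‖ ^ 2) :
    t ^ 2 * (c * ‖x₂ - x₁‖ ^ 2 + (Φ x₂ - m))
      ≤ t ^ 2 * (Φ x₁ - m) + (τ - 1) ^ 2 * (c * ‖x₁ - x₀‖ ^ 2) := by
  have h := hstep x₁ hx₁
  rw [sub_add_cancel_left, norm_neg, norm_smul, mul_pow, Real.norm_eq_abs, sq_abs,
    norm_sub_rev x₁ x₂] at h
  have h3 := mul_le_mul_of_nonneg_left h (sq_nonneg t)
  have e : t ^ 2 * (Φ x₁ + c * (((τ - 1) / t) ^ 2 * ‖x₁ - x₀‖ ^ 2))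
      = t ^ 2 * Φ x₁ + (τ - 1) ^ 2 * (c * ‖x₁ - x₀‖ ^ 2) := by
    field_simp
  rw [e] at h3
  linarith

theorem theorem3p2 {H : Type*} [NormedAddCommGroup H] [InnerProductSpace ℝ H] [CompleteSpace H]
    (F : H → ℝ) (R : H → EReal) (L : ℝ≥0) (γ p q : ℝ) (x₀ : H)
    (hRproper : ProperFun R) (hRconv : ConvexFun R) (hRlsc : LowerSemicontinuous R)
    (hFconv : ConvexOn ℝ Set.univ F) (hFdiff : Differentiable ℝ F)
    (hL : 0 < L) (hFlip : LipschitzWith L (gradient F))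
    (hmin : ∃ z, IsGlobalMin (objective F R) z)
    (hγ : 0 < γ) (hγL : γ ≤ 1 / (L : ℝ))
    (hp : p ∈ Set.Ioo (0 : ℝ) 1) (hq : q ∈ Set.Icc (p ^ 2) ((2 - p) ^ 2)) :
    (∃ xs : H, IsGlobalMin (objective F R) xs ∧
      Tendsto (fun k => toWeakSpace ℝ H (fistaMod F R γ p q 4 x₀ k)) atTop
        (𝓝 (toWeakSpace ℝ H xs))) ∧
    (fun k : ℕ => ‖fistaMod F R γ p q 4 x₀ k - fistaMod F R γ p q 4 x₀ (k - 1)‖)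
      =o[atTop] (fun k : ℕ => 1 / (k : ℝ)) := by
  set x := fistaMod F R γ p q 4 x₀ with hx
  set t := fistaT p q 4 with ht
  set c : ℝ := 1 / (2 * γ) with hc
  set Φ : H → ℝ := fun y => F y + (R y).toReal with hΦ
  have hc0 : 0 < c := by positivity
  have ht1 : ∀ n, 1 ≤ t n := one_le_fistaT hp.1.le hq.1
  have hΦc : ConvexOn ℝ (effDomain R) Φ :=
    (hFconv.subset (Set.subset_univ _) (hRconv.convexOn_toReal hRproper).1).add
      (hRconv.convexOn_toReal hRproper)
  have hfb := forwardBackward_spec hRproper hRconv hRlsc hFconv hFdiff hFlip hL hmin hγ hγL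
  -- `x₀` itself may lie outside the domain of `R`
  have hdom : ∀ n, x (n + 1) ∈ effDomain R := fun n => by
    cases n with
    | zero => exact (hfb _).1
    | succ n => exact (hfb _).1
  have hstep : ∀ n, ∀ v ∈ effDomain R, Φ (x (n + 2)) + c * ‖v - x (n + 2)‖ ^ 2
      ≤ Φ v + c * ‖v - (x (n + 1) + ((t n - 1) / t (n + 1)) • (x (n + 1) - x n))‖ ^ 2 :=
    fun n => (hfb _).2
  have henergy : ∀ z, IsGlobalMin (objective F R) z →
      Tendsto (fun n => t n ^ 2 * (Φ (x (n + 1)) - Φ z)) atTop (𝓝 0) ∧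
      Tendsto (fun n => t n ^ 2 * (c * ‖x (n + 1) - x n‖ ^ 2)) atTop (𝓝 0) ∧
      ∃ l, Tendsto (fun n => c * ‖x n + t n • (x (n + 1) - x n) - z‖ ^ 2) atTop (𝓝 l) := by
    intro z hz
    obtain ⟨hzD, hzmin⟩ := hRproper.isGlobalMin_objective_iff.1 hz
    exact tendsto_of_energy_estimates hp.1 hp.2 hq.1 hq.2
      (fun n => sub_nonneg.2 (hzmin _ (hdom n))) (fun n => by positivity) (fun n => by positivity)
      (fun n => hΦc.inertial_step_energy_le (ht1 (n + 1)) (hdom n) hzD (hstep n))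
      (fun n => inertial_step_increment_le (zero_lt_one.trans_le (ht1 (n + 1))) _ (hdom n)
        (hstep n))
  obtain ⟨z₀, hz₀⟩ := hmin
  have htΔ : Tendsto (fun n => t n * ‖x (n + 1) - x n‖) atTop (𝓝 0) := by
    have h := ((henergy z₀ hz₀).2.1.const_mul c⁻¹).sqrt
    rw [mul_zero, Real.sqrt_zero] at h
    refine h.congr fun n => ?_
    rw [← Real.sqrt_sq (mul_nonneg (zero_le_one.trans (ht1 n)) (norm_nonneg (x (n + 1) - x n)))]
    congr 1
    field_simp
  have hgap : ∀ z, IsGlobalMin (objective F R) z →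
      Tendsto (fun n => Φ (x (n + 1)) - Φ z) atTop (𝓝 0) := fun z hz =>
    squeeze_zero
      (fun n => sub_nonneg.2 ((hRproper.isGlobalMin_objective_iff.1 hz).2 _ (hdom n)))
      (fun n => le_mul_of_one_le_left
        (sub_nonneg.2 ((hRproper.isGlobalMin_objective_iff.1 hz).2 _ (hdom n)))
        (one_le_pow₀ (ht1 n))) (henergy z hz).1
  constructor
  · refine exists_tendsto_toWeakSpace_of_opial (S := {z | IsGlobalMin (objective F R) z})
      ⟨z₀, hz₀⟩ (fun z hz => ?_) (fun 𝒰 y h𝒰 hy => ?_)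
    · -- the distance of the extrapolated points to `z` converges, and these points are
      -- asymptotically the iterates
      obtain ⟨l, hl⟩ := (henergy z hz).2.2
      have hu : Tendsto (fun n => ‖x n + t n • (x (n + 1) - x n) - z‖) atTop (𝓝 √(c⁻¹ * l)) := by
        refine (hl.const_mul c⁻¹).sqrt.congr fun n => ?_
        rw [inv_mul_cancel_left₀ hc0.ne', Real.sqrt_sq (norm_nonneg _)]
      have hdiff : Tendsto (fun n => ‖x n - z‖ - ‖x n + t n • (x (n + 1) - x n) - z‖) atTop
          (𝓝 0) := by
        refine squeeze_zero_norm (fun n => ?_) htΔ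
        refine (abs_norm_sub_norm_le _ _).trans_eq ?_
        rw [show x n - z - (x n + t n • (x (n + 1) - x n) - z) = -(t n • (x (n + 1) - x n)) by abel,
          norm_neg, norm_smul, Real.norm_of_nonneg (zero_le_one.trans (ht1 n))]
      exact ⟨_, by simpa using hdiff.add hu⟩
    · obtain ⟨hzD, hzmin⟩ := hRproper.isGlobalMin_objective_iff.1 hz₀
      have hlevel : ∀ ε > 0, y ∈ effDomain R ∧ Φ y ≤ Φ z₀ + ε := by
        intro ε hε
        have hev : ∀ᶠ n in atTop, x n ∈ {v | v ∈ effDomain R ∧ Φ v ≤ Φ z₀ + ε} := by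
          rw [← map_add_atTop_eq_nat 1, eventually_map]
          filter_upwards [(hgap z₀ hz₀).eventually (gt_mem_nhds hε)] with n hn
          exact ⟨hdom n, by linarith⟩
        refine mem_of_tendsto_toWeakSpace (s := {v | v ∈ effDomain R ∧ Φ v ≤ Φ z₀ + ε})
          (hΦc.convex_le _) ?_ (h𝒰 hev) hy
        convert hRproper.isClosed_toReal_le hRlsc
          (g := fun v => Φ z₀ + ε - F v) (continuous_const.sub hFdiff.continuous) using 4 with v
        exact le_sub_iff_add_le'.symm
      refine hRproper.isGlobalMin_objective_iff.2 ⟨(hlevel 1 one_pos).1, fun v hv => ?_⟩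
      exact (le_of_forall_pos_le_add fun ε hε => (hlevel ε hε).2).trans (hzmin v hv)
  · have hpos : 0 < p / 2 := half_pos hp.1
    have hn : Tendsto (fun n : ℕ => ((n : ℝ) + 1) * ‖x (n + 1) - x n‖) atTop (𝓝 0) := by
      have h := htΔ.const_mul (p / 2)⁻¹
      rw [mul_zero] at h
      refine squeeze_zero (fun n => by positivity) (fun n => ?_) h
      rw [← mul_assoc]
      refine mul_le_mul_of_nonneg_right ?_ (norm_nonneg _)
      rw [le_inv_mul_iff₀ hpos]
      exact le_fistaT (hp.2.le.trans one_le_two) hq.1 n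
    rw [isLittleO_iff_tendsto' ?_]
    · refine (tendsto_add_atTop_iff_nat 1).1 (hn.congr fun n => ?_)
      simp [mul_comm]
    · filter_upwards [eventually_gt_atTop 0] with n hn0 h0
      have : (0 : ℝ) < 1 / n := by positivity
      exact absurd h0 this.ne'
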